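/- For $x=(x_n)_{n\ge1}\in\mathbb C^{\mathbb N}$ put $|x|=(|x_n|)_n$ and let $C(x)=\bigl(\tfrac1n\sum_{k=1}^n x_k\bigr)_n$ be the Cesàro operator. For $1<q<\infty$ let $\mathrm{ces}(q)=\{x\in\mathbb C^{\mathbb N}: C(|x|)\in\ell_q\}$ with norm $\|x\|_{\mathrm{ces}(q)}=\|C(|x|)\|_q$, and let $d(q)=\{x\in\ell_\infty:\hat x\in\ell_q\}$, where $\hat x=(\sup_{k\ge n}|x_k|)_n$, with norm $\|x\|_{d(q)}=\|\hat x\|_q$. For $E\in\{\mathrm{ces},d\}$ let $E(p+)=\bigcap_{p<q<\infty}E(q)$ for $1\le p<\infty$, with the Fréchet topology given by the norms $\|\cdot\|_{E(q)}$, $p<q<\infty$, and let $E(p-)=\bigcup_{1<q<p}E(q)$ for $1<p\le\infty$, with the locally convex inductive limit topology of the Banach spaces $E(q)$, $1<q<p$. A linear subspace $X\subseteq\mathbb C^{\mathbb N}$ is solid if $x\in X$, $y\in\mathbb C^{\mathbb N}$ and $|y|\le|x|$ coordinatewise imply $y\in X$; for a linear subspace $Y\subseteq\mathbb C^{\mathbb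 N}$, $[C,Y]_s$ denotes the largest solid linear subspace $X\subseteq\mathbb C^{\mathbb N}$ with $C(X)\subseteq Y$ (if it exists). (i) (a) For all $1\le p\le q<\infty$, $C$ maps $d(p+)$ into $d(q+)$ and $\mathrm{ces}(p+)$ into $d(q+)$, and both operators $C:d(p+)\to d(q+)$ and $C:\mathrm{ces}(p+)\to d(q+)$ are continuous. (b) For all $1\le p<\infty$ and $x\in\mathbb C^{\mathbb N}$: $C^2(|x|)\in d(p+)$ if and only if $C(|x|)\in d(p+)$. (c) For all $1\le p<\infty$, $[C,d(p+)]_s$ exists and equals $\mathrm{ces}(p+)$. (ii) (a) For all $1<p\le q\le\infty$, $C$ maps $d(p-)$ into $d(q-)$ and $\mathrm{ces}(p-)$ into $d(q-)$, and both operators $C:d(p-)\to d(q-)$ and $C:\mathrm{ces}(p-)\to d(q-)$ are continuous. (b) For all $1<p\le\infty$ and $x\in\mathbb C^{\mathbb N}$: $C^2(|x|)\in d(p-)$ if and only if $C(|x|)\in d(p-)$. (c) For all $1<p\le\infty$, $[C,d(p-)]_s$ exists and equals $\mathrm{ces}(p-)$. -/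

import Mathlib

open scoped ENNReal

noncomputable section

namespace CesaroScale

/-- The vector space `ℂ^ℕ` of all complex sequences; the `n`-th term (`n ≥ 1`) of a sequence is
stored at index `n - 1`. -/
abbrev CSeq : Type := ℕ → ℂ

/-- The Cesàro operator `x ↦ ((x_1 + ⋯ + x_n) / n)_{n ≥ 1}` on `ℂ^ℕ` (with indices shifted by one). -/
def cesaro : CSeq →ₗ[ℂ] CSeq where
  toFun x n := (∑ k ∈ Finset.range (n + 1), x k) / ((n : ℂ) + 1)
  map_add' x y := by
    funext n
    simp [Finset.sum_add_distrib, add_div]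
  map_smul' c x := by
    funext n
    simp [← Finset.mul_sum, mul_div_assoc]

/-- The coordinatewise modulus `|x|`. -/
def modulus (x : CSeq) : CSeq := fun n => ((‖x n‖ : ℝ) : ℂ)

/-- The least decreasing majorant `x̂_n = sup_{k ≥ n} |x_k|` (used for bounded `x` only). -/
def hat (x : CSeq) : ℕ → ℝ := fun n => ⨆ k : ℕ, ‖x (n + k)‖

/-- The exponents `1 < q < ∞`. -/
abbrev Exponent : Type := {q : ℝ≥0∞ // 1 < q ∧ q < ∞}

instance (q : Exponent) : Fact (1 ≤ q.1) := ⟨q.2.1.le⟩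

theorem norm_cesaro_modulus (x : CSeq) (n : ℕ) :
    ‖cesaro (modulus x) n‖ = (∑ k ∈ Finset.range (n + 1), ‖x k‖) / ((n : ℝ) + 1) := by
  have h : cesaro (modulus x) n =
      (((∑ k ∈ Finset.range (n + 1), ‖x k‖) / ((n : ℝ) + 1) : ℝ) : ℂ) := by
    simp [cesaro, modulus]
  rw [h, Complex.norm_real, Real.norm_of_nonneg]
  positivity

theorem norm_cesaro_modulus_add_le (x y : CSeq) (n : ℕ) :
    ‖cesaro (modulus (x + y)) n‖ ≤ ‖(cesaro (modulus x) + cesaro (modulus y)) n‖ := by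
  have h : (cesaro (modulus x) + cesaro (modulus y)) n =
      (((∑ k ∈ Finset.range (n + 1), ‖x k‖) / ((n : ℝ) + 1) +
        (∑ k ∈ Finset.range (n + 1), ‖y k‖) / ((n : ℝ) + 1) : ℝ) : ℂ) := by
    simp [cesaro, modulus]
  rw [h, Complex.norm_real, Real.norm_of_nonneg (by positivity), norm_cesaro_modulus, ← add_div,
    ← Finset.sum_add_distrib]
  gcongr
  exact norm_add_le _ _

theorem norm_cesaro_modulus_smul (c : ℂ) (x : CSeq) (n : ℕ) :
    ‖cesaro (modulus (c • x)) n‖ = ‖(c • cesaro (modulus x)) n‖ := by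
  rw [norm_cesaro_modulus, Pi.smul_apply, norm_smul, norm_cesaro_modulus]
  simp [← Finset.mul_sum, mul_div_assoc]

/-- `ces(q) = {x : C(|x|) ∈ ℓ_q}`. -/
def ces (q : Exponent) : Submodule ℂ CSeq where
  carrier := {x | Memℓp (cesaro (modulus x)) q.1}
  add_mem' {x y} hx hy := Memℓp.mono' (hx.add hy) (norm_cesaro_modulus_add_le x y)
  zero_mem' := Memℓp.mono' (zero_memℓp (E := fun _ : ℕ => ℂ)) fun n => by
    rw [norm_cesaro_modulus]; simp
  smul_mem' c x hx :=
    Memℓp.mono' (Memℓp.const_smul hx c) fun n => (norm_cesaro_modulus_smul c x n).le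

/-- The sequence `C(|x|)`, as an element of `ℓ_q`, of a sequence `x` in `ces(q)`. -/
def cesLp (q : Exponent) (x : ces q) : lp (fun _ : ℕ => ℂ) q.1 := ⟨cesaro (modulus x.1), x.2⟩

theorem norm_cesLp_add_le (q : Exponent) (x y : ces q) :
    ‖cesLp q (x + y)‖ ≤ ‖cesLp q x‖ + ‖cesLp q y‖ := by
  have h : ‖cesLp q (x + y)‖ ≤ ‖cesLp q x + cesLp q y‖ :=
    lp.norm_mono (zero_lt_one.trans q.2.1).ne' fun n => norm_cesaro_modulus_add_le x.1 y.1 n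
  exact h.trans (norm_add_le _ _)

theorem norm_cesLp_smul (q : Exponent) (c : ℂ) (x : ces q) :
    ‖cesLp q (c • x)‖ = ‖c‖ * ‖cesLp q x‖ := by
  have h0 := (zero_lt_one.trans q.2.1).ne'
  have h : ‖cesLp q (c • x)‖ = ‖c • cesLp q x‖ := le_antisymm
    (lp.norm_mono h0 fun n => (norm_cesaro_modulus_smul c x.1 n).le)
    (lp.norm_mono h0 fun n => (norm_cesaro_modulus_smul c x.1 n).ge)
  rw [h, norm_smul]

/-- The norm `‖x‖_{ces(q)} = ‖C(|x|)‖_q` of `ces(q)`. -/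
def cesNorm (q : Exponent) : Seminorm ℂ (ces q) :=
  Seminorm.of (fun x => ‖cesLp q x‖) (norm_cesLp_add_le q) (norm_cesLp_smul q)

theorem hat_nonneg (x : CSeq) (n : ℕ) : 0 ≤ hat x n := Real.iSup_nonneg fun _ => norm_nonneg _

theorem norm_le_hat {x : CSeq} (hx : Memℓp x ∞) (n k : ℕ) : ‖x (n + k)‖ ≤ hat x n := by
  refine le_ciSup (f := fun k => ‖x (n + k)‖) ?_ k
  obtain ⟨M, hM⟩ := memℓp_infty_iff.1 hx
  exact ⟨M, by rintro _ ⟨j, rfl⟩; exact hM ⟨n + j, rfl⟩⟩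

theorem norm_hat_add_le {x y : CSeq} (hx : Memℓp x ∞) (hy : Memℓp y ∞) (n : ℕ) :
    ‖hat (x + y) n‖ ≤ ‖(hat x + hat y) n‖ := by
  rw [Pi.add_apply, Real.norm_of_nonneg (hat_nonneg _ _),
    Real.norm_of_nonneg (add_nonneg (hat_nonneg _ _) (hat_nonneg _ _))]
  exact ciSup_le fun k =>
    (norm_add_le _ _).trans (add_le_add (norm_le_hat hx n k) (norm_le_hat hy n k))

theorem hat_smul (c : ℂ) (x : CSeq) : hat (c • x) = ‖c‖ • hat x := by
  funext n
  simp [hat, Real.mul_iSup_of_nonneg (norm_nonneg c)]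

/-- `d(q) = {x ∈ ℓ_∞ : x̂ ∈ ℓ_q}`. -/
def d (q : Exponent) : Submodule ℂ CSeq where
  carrier := {x | Memℓp x ∞ ∧ Memℓp (hat x) q.1}
  add_mem' {x y} hx hy :=
    ⟨hx.1.add hy.1, Memℓp.mono' (hx.2.add hy.2) (norm_hat_add_le hx.1 hy.1)⟩
  zero_mem' := ⟨zero_memℓp, Memℓp.mono' (zero_memℓp (E := fun _ : ℕ => ℝ)) fun n => by simp [hat]⟩
  smul_mem' c x hx := ⟨hx.1.const_smul c, by rw [hat_smul]; exact hx.2.const_smul ‖c‖⟩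

/-- The sequence `x̂`, as an element of `ℓ_q`, of a sequence `x` in `d(q)`. -/
def dLp (q : Exponent) (x : d q) : lp (fun _ : ℕ => ℝ) q.1 := ⟨hat x.1, x.2.2⟩

theorem norm_dLp_add_le (q : Exponent) (x y : d q) :
    ‖dLp q (x + y)‖ ≤ ‖dLp q x‖ + ‖dLp q y‖ := by
  have h : ‖dLp q (x + y)‖ ≤ ‖dLp q x + dLp q y‖ :=
    lp.norm_mono (zero_lt_one.trans q.2.1).ne' fun n => norm_hat_add_le x.2.1 y.2.1 n
  exact h.trans (norm_add_le _ _)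

theorem norm_dLp_smul (q : Exponent) (c : ℂ) (x : d q) :
    ‖dLp q (c • x)‖ = ‖c‖ * ‖dLp q x‖ := by
  have h : dLp q (c • x) = ‖c‖ • dLp q x := lp.ext (hat_smul c x.1)
  rw [h, norm_smul, norm_norm]

/-- The norm `‖x‖_{d(q)} = ‖x̂‖_q` of `d(q)`. -/
def dNorm (q : Exponent) : Seminorm ℂ (d q) :=
  Seminorm.of (fun x => ‖dLp q x‖) (norm_dLp_add_le q) (norm_dLp_smul q)

/-- A scale of (semi)normed sequence spaces `E(q)`, `1 < q < ∞`, increasing in `q`. It only serves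
to define `E(p+)` and `E(p-)` at once for the two scales `ces` and `d`. -/
structure Scale where
  space : Exponent → Submodule ℂ CSeq
  norm : ∀ q, Seminorm ℂ (space q)
  mono : Monotone space

/-- The scale of the spaces `ces(q)`. -/
def cesScale : Scale where
  space := ces
  norm := cesNorm
  mono _ _ h _ hx := Memℓp.of_exponent_ge hx h

/-- The scale of the spaces `d(q)`. -/
def dScale : Scale where
  space := d
  norm := dNorm
  mono _ _ h _ hx := ⟨hx.1, Memℓp.of_exponent_ge hx.2 h⟩

namespace Scale

variable (E : Scale)

/-- The norm topology of the space `E(q)`. -/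
abbrev normTopology (q : Exponent) : TopologicalSpace (E.space q) :=
  (E.norm q).toSeminormedAddCommGroup.toUniformSpace.toTopologicalSpace

/-- `E(p+) = ⋂_{p < q < ∞} E(q)`, for `1 ≤ p < ∞`. -/
def plus (p : ℝ≥0∞) : Submodule ℂ CSeq where
  carrier := {x | ∀ q : Exponent, p < q.1 → x ∈ E.space q}
  add_mem' hx hy q hq := add_mem (hx q hq) (hy q hq)
  zero_mem' _ _ := zero_mem _
  smul_mem' c _ hx q hq := Submodule.smul_mem _ c (hx q hq)

theorem plus_le {p : ℝ≥0∞} (q : Exponent) (hq : p < q.1) : E.plus p ≤ E.space q :=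
  fun _ hx => hx q hq

/-- The topology of `E(p+)` given by all the norms of the spaces `E(q)`, `p < q < ∞`. -/
abbrev plusTopology (p : ℝ≥0∞) : TopologicalSpace (E.plus p) :=
  ⨅ (q : Exponent) (hq : p < q.1),
    (E.normTopology q).induced (Submodule.inclusion (E.plus_le q hq))

/-- `E(p-) = ⋃_{1 < q < p} E(q)`, for `1 < p ≤ ∞`. (The alternative `x = 0` only matters for `p ≤ 1`,
where the union is empty.) -/
def minus (p : ℝ≥0∞) : Submodule ℂ CSeq where
  carrier := {x | x = 0 ∨ ∃ q : Exponent, q.1 < p ∧ x ∈ E.space q}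
  add_mem' {x y} := by
    rintro (rfl | ⟨q, hq, hx⟩) (rfl | ⟨r, hr, hy⟩)
    · simp
    · exact Or.inr ⟨r, hr, by simpa using hy⟩
    · exact Or.inr ⟨q, hq, by simpa using hx⟩
    · rcases le_total q r with h | h
      · exact Or.inr ⟨r, hr, add_mem (E.mono h hx) hy⟩
      · exact Or.inr ⟨q, hq, add_mem hx (E.mono h hy)⟩
  zero_mem' := Or.inl rfl
  smul_mem' c x := by
    rintro (rfl | ⟨q, hq, hx⟩)
    · simp
    · exact Or.inr ⟨q, hq, Submodule.smul_mem _ c hx⟩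

theorem le_minus {p : ℝ≥0∞} (q : Exponent) (hq : q.1 < p) : E.space q ≤ E.minus p :=
  fun _ hx => Or.inr ⟨q, hq, hx⟩

theorem mem_minus {p : ℝ≥0∞} (hp : 1 < p) {x : CSeq} :
    x ∈ E.minus p ↔ ∃ q : Exponent, q.1 < p ∧ x ∈ E.space q := by
  refine ⟨?_, Or.inr⟩
  rintro (rfl | h)
  · obtain ⟨q, h1, h2⟩ := exists_between hp
    exact ⟨⟨q, h1, h2.trans_le le_top⟩, h2, zero_mem _⟩
  · exact h

/-- The (locally convex) inductive limit topology of `E(p-)`: the finest locally convex vector space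
topology for which all inclusions `E(q) → E(p-)`, `1 < q < p`, are continuous. -/
abbrev minusTopology (p : ℝ≥0∞) : TopologicalSpace (E.minus p) :=
  sInf {t | @IsTopologicalAddGroup (E.minus p) t _ ∧
    @ContinuousSMul ℂ (E.minus p) _ _ t ∧
    @LocallyConvexSpace ℝ (E.minus p) _ _ _ _ t ∧
    ∀ (q : Exponent) (hq : q.1 < p),
      @Continuous _ _ (E.normTopology q) t (Submodule.inclusion (E.le_minus q hq))}

end Scale

/-- The Cesàro operator maps `X` into `Y`, and is continuous as a map from `X` to `Y` for the given
topologies. -/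
def CesaroContinuous (X Y : Submodule ℂ CSeq) (tX : TopologicalSpace X) (tY : TopologicalSpace Y) :
    Prop :=
  ∃ h : ∀ x ∈ X, cesaro x ∈ Y, @Continuous X Y tX tY (cesaro.restrict h)

/-- A linear subspace `X` of `ℂ^ℕ` is solid if `x ∈ X` and `|y| ≤ |x|` imply `y ∈ X`. -/
def IsSolid (X : Submodule ℂ CSeq) : Prop :=
  ∀ x ∈ X, ∀ y : CSeq, (∀ n, ‖y n‖ ≤ ‖x n‖) → y ∈ X

/-- `X = [C, Y]_s`, i.e. `X` is the largest solid linear subspace of `ℂ^ℕ` that the Cesàro operator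
maps into `Y`. -/
def IsLargestSolidDomain (Y X : Submodule ℂ CSeq) : Prop :=
  IsGreatest {Z : Submodule ℂ CSeq | IsSolid Z ∧ ∀ x ∈ Z, cesaro x ∈ Y} X

end CesaroScale

end

open CesaroScale

/-! Everything reduces to one exponent `q`, because `q` is never changed: the estimates then pass to
intersections and unions over `q`. For fixed `q` there are four facts. `C : ces(q) → d(q)` is
bounded (`exists_cesaro_mem_d_norm_le`). The inclusion `d(q) ⊆ ces(q)` is bounded, by Hardy's
inequality. `C|x| ∈ d(q)` forces `x ∈ ces(q)`, as a bounded sequence is dominated by its decreasing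
majorant. Finally `C²|x| ∈ d(q)` forces `C|x| ∈ d(q)`. The first and last rest on the slow decay of
averages `A` of a nonnegative sequence: `A n ≤ 2 * A m` for `n ≤ m ≤ 2n+1`. Hence `A n` is
controlled by the mean of `A` up to `2n+1`, and `A n ^ s` by a weighted tail sum, which also
controls all later averages. -/

namespace CesaroScale

/-! ### Slow decay of averages -/

section Averages

/-- The sequence of averages of a real sequence. -/
noncomputable def average (a : ℕ → ℝ) (n : ℕ) : ℝ :=
  (∑ k ∈ Finset.range (n + 1), a k) / ((n : ℝ) + 1)

variable {a : ℕ → ℝ}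

theorem average_nonneg (ha : ∀ n, 0 ≤ a n) (n : ℕ) : 0 ≤ average a n :=
  div_nonneg (Finset.sum_nonneg fun k _ => ha k) (by positivity)

theorem average_mono {b : ℕ → ℝ} (hab : ∀ n, a n ≤ b n) (n : ℕ) : average a n ≤ average b n := by
  unfold average
  gcongr with k
  exact hab k

theorem succ_mul_average (a : ℕ → ℝ) (n : ℕ) :
    ((n : ℝ) + 1) * average a n = ∑ k ∈ Finset.range (n + 1), a k :=
  mul_div_cancel₀ _ (by positivity)

/-- Partial sums of `a` increase, while the divisor at most doubles since `m + 1 ≤ 2 * (n + 1)`. -/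
theorem average_le_two_mul_average (ha : ∀ n, 0 ≤ a n) {n m : ℕ} (hnm : n ≤ m)
    (hm : m ≤ 2 * n + 1) : average a n ≤ 2 * average a m := by
  have hsum : ∑ k ∈ Finset.range (n + 1), a k ≤ ∑ k ∈ Finset.range (m + 1), a k :=
    Finset.sum_le_sum_of_subset_of_nonneg (Finset.range_mono (by lia)) fun k _ _ => ha k
  have hm' : (m : ℝ) ≤ 2 * n + 1 := by exact_mod_cast hm
  rw [← succ_mul_average, ← succ_mul_average] at hsum
  have h0 := average_nonneg ha m
  have hn : (0 : ℝ) < (n : ℝ) + 1 := by positivity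
  refine le_of_mul_le_mul_left (hsum.trans ?_) hn
  nlinarith

theorem average_le_four_mul_average_average (ha : ∀ n, 0 ≤ a n) (n : ℕ) :
    average a n ≤ 4 * average (average a) (2 * n + 1) := by
  -- The block from `n` to `2n+1` has `n+2` terms, each at least half of `average a n`; dividing by
  -- `2n+2` leaves more than a quarter.
  have h1 : ∑ k ∈ Finset.Ico n (2 * n + 2), average a n / 2 ≤
      ∑ k ∈ Finset.range (2 * n + 1 + 1), average a k := by
    refine (Finset.sum_le_sum fun k hk => ?_).trans
      (Finset.sum_le_sum_of_subset_of_nonneg (f := average a) (s := Finset.Ico n (2 * n + 2)) ?_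
        fun k _ _ => average_nonneg ha k)
    · rw [Finset.mem_Ico] at hk
      linarith [average_le_two_mul_average ha hk.1 (by lia)]
    · intro k hk
      rw [Finset.mem_Ico] at hk
      exact Finset.mem_range.2 hk.2
  rw [← succ_mul_average, Finset.sum_const, Nat.card_Ico, nsmul_eq_mul,
    show 2 * n + 2 - n = n + 2 by lia] at h1
  push_cast at h1
  have h0 := average_nonneg ha n
  have hn : (0 : ℝ) < (n : ℝ) + 1 := by positivity
  refine le_of_mul_le_mul_left ?_ hn
  nlinarith

/-! ### Hardy's inequality -/

theorem rpow_sub_one_mul_self {s t : ℝ} (hs : 0 < s) (ht : 0 ≤ t) : t ^ (s - 1) * t = t ^ s := by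
  rcases ht.eq_or_lt with rfl | h
  · rw [mul_zero, Real.zero_rpow hs.ne']
  · rw [← Real.rpow_add_one h.ne', sub_add_cancel]

/-- The telescoping estimate behind the Hardy inequality. -/
theorem average_rpow_le {s : ℝ} (hs : 1 < s) (ha : ∀ n, 0 ≤ a n) (n : ℕ) :
    (s - 1) * average a n ^ s + ((n : ℝ) + 1) * average a n ^ s ≤
      s * (average a n ^ (s - 1) * a n) + n * average a (n - 1) ^ s := by
  set A := average a n with hA
  set B := average a (n - 1) with hB
  have hA0 : 0 ≤ A := average_nonneg ha n
  have hB0 : 0 ≤ B := average_nonneg ha (n - 1)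
  -- At `n = 0` the truncated index `n - 1` is harmless: `B` has coefficient `n`.
  have hrec : ((n : ℝ) + 1) * A = n * B + a n := by
    rw [hA, succ_mul_average, Finset.sum_range_succ]
    congr 1
    rcases n with _ | n
    · simp
    · rw [hB, ← succ_mul_average]
      simp
  have hpow : A ^ s = A ^ (s - 1) * A := (rpow_sub_one_mul_self (by linarith) hA0).symm
  have hconj : (s / (s - 1)).HolderConjugate s :=
    (Real.HolderConjugate.conjExponent hs).symm
  have hy := Real.young_inequality_of_nonneg (Real.rpow_nonneg hA0 (s - 1)) hB0 hconj
  have hs1 : 0 < s - 1 := by linarith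
  rw [← Real.rpow_mul hA0, mul_div_cancel₀ _ hs1.ne'] at hy
  have hy' : s * (A ^ (s - 1) * B) ≤ (s - 1) * A ^ s + B ^ s := by
    calc s * (A ^ (s - 1) * B) ≤ s * (A ^ s / (s / (s - 1)) + B ^ s / s) := by gcongr
      _ = _ := by field_simp
  have han : a n = ((n : ℝ) + 1) * A - n * B := by linarith
  have hn : (0 : ℝ) ≤ n := by positivity
  have := mul_le_mul_of_nonneg_left hy' hn
  rw [han]
  have e : s * (A ^ (s - 1) * (((n : ℝ) + 1) * A - n * B)) =
    s * ((n : ℝ) + 1) * A ^ s - n * (s * (A ^ (s - 1) * B)) := by rw [hpow]; ring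
  rw [e]
  nlinarith

/-- A discrete Hardy inequality, with a non-optimal constant. -/
theorem sum_average_rpow_le {s : ℝ} (hs : 1 < s) (ha : ∀ n, 0 ≤ a n) (N : ℕ) :
    ∑ n ∈ Finset.range N, average a n ^ s ≤
      (2 * s / (s - 1)) ^ s * ∑ n ∈ Finset.range N, a n ^ s := by
  have hs1 : 0 < s - 1 := by linarith
  set c := 2 * s / (s - 1) with hc
  have hc0 : 0 < c := by positivity
  have hcs : (s - 1) * c = 2 * s := mul_div_cancel₀ _ hs1.ne'
  have hA := average_nonneg ha
  -- By the choice of `c`, the left side is `(s - 1) * average a n ^ (s - 1) * (c * a n)`; replacing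
  -- the smaller of `average a n` and `c * a n` by the larger gives one of the two terms on the
  -- right.
  have hmix (n : ℕ) : 2 * s * (average a n ^ (s - 1) * a n) ≤
      (s - 1) * average a n ^ s + (s - 1) * (c ^ s * a n ^ s) := by
    rcases le_total (average a n) (c * a n) with h | h
    · have h1 : average a n ^ (s - 1) ≤ (c * a n) ^ (s - 1) :=
        Real.rpow_le_rpow (hA n) h hs1.le
      have h2 : (c * a n) ^ (s - 1) * (c * a n) = c ^ s * a n ^ s := by
        rw [← Real.mul_rpow hc0.le (ha n)]
        exact rpow_sub_one_mul_self (by linarith) (mul_nonneg hc0.le (ha n))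
      have h3 := mul_le_mul_of_nonneg_right h1 (mul_nonneg hc0.le (ha n))
      rw [h2] at h3
      have h4 : 0 ≤ (s - 1) * average a n ^ s := mul_nonneg hs1.le (Real.rpow_nonneg (hA n) s)
      have h5 := mul_le_mul_of_nonneg_left h3 hs1.le
      rw [← hcs]
      linarith
    · have h2 : average a n ^ (s - 1) * average a n = average a n ^ s :=
        rpow_sub_one_mul_self (by linarith) (hA n)
      have h3 := mul_le_mul_of_nonneg_left h (Real.rpow_nonneg (hA n) (s - 1))
      rw [h2] at h3
      have h4 : 0 ≤ (s - 1) * (c ^ s * a n ^ s) :=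
        mul_nonneg hs1.le (mul_nonneg (Real.rpow_nonneg hc0.le s) (Real.rpow_nonneg (ha n) s))
      have h5 := mul_le_mul_of_nonneg_left h3 hs1.le
      rw [← hcs]
      linarith
  -- Twice the telescoping estimate leaves a spare `(s - 1) * average a n ^ s` to absorb the first
  -- term of `hmix`. The boundary term is kept for the induction and dropped at the end.
  have key : ∀ N : ℕ, (s - 1) * ∑ n ∈ Finset.range N, average a n ^ s +
      2 * (N * average a (N - 1) ^ s) ≤
        (s - 1) * (c ^ s * ∑ n ∈ Finset.range N, a n ^ s) := by
    intro N
    induction N with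
    | zero => simp
    | succ n ih =>
      rw [Finset.sum_range_succ, Finset.sum_range_succ]
      have h1 := average_rpow_le hs ha n
      have h2 := hmix n
      push_cast
      nlinarith
  have hN : 0 ≤ 2 * (N * average a (N - 1) ^ s) :=
    mul_nonneg zero_le_two (mul_nonneg (Nat.cast_nonneg N) (Real.rpow_nonneg (hA _) s))
  exact le_of_mul_le_mul_left (by linarith [key N]) hs1

/-! ### Tail sums controlling the decreasing majorant -/

theorem average_rpow_le_sum {s : ℝ} (hs : 0 ≤ s) (ha : ∀ n, 0 ≤ a n) (n : ℕ) :
    average a n ^ s ≤ 2 * 2 ^ s *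
      ∑ m ∈ Finset.Ico n (2 * n + 2), average a m ^ s / ((m : ℝ) + 1) := by
  have hA := average_nonneg ha
  -- Slow decay costs `2 ^ s`, the weight a further `2`; the `n+2` terms of the block make up for
  -- the factor `n+1`.
  have h : ∑ m ∈ Finset.Ico n (2 * n + 2), (average a n / 2) ^ s / (2 * ((n : ℝ) + 1)) ≤
      ∑ m ∈ Finset.Ico n (2 * n + 2), average a m ^ s / ((m : ℝ) + 1) := by
    refine Finset.sum_le_sum fun m hm => ?_
    rw [Finset.mem_Ico] at hm
    have hm' : (m : ℝ) + 1 ≤ 2 * (n + 1) := by exact_mod_cast (by lia : m + 1 ≤ 2 * (n + 1))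
    have := average_le_two_mul_average ha hm.1 (by lia)
    have h0 := hA n
    refine div_le_div₀ (Real.rpow_nonneg (hA m) s) ?_ (by positivity) hm'
    exact Real.rpow_le_rpow (by positivity) (by linarith) hs
  rw [Finset.sum_const, Nat.card_Ico, nsmul_eq_mul, show 2 * n + 2 - n = n + 2 by lia,
    Real.div_rpow (hA n) zero_le_two] at h
  push_cast at h
  have h2 : (0 : ℝ) < 2 ^ s := by positivity
  have h0 : 0 ≤ average a n ^ s := Real.rpow_nonneg (hA n) s
  refine le_trans ?_ (mul_le_mul_of_nonneg_left h (by positivity : (0 : ℝ) ≤ 2 * 2 ^ s))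
  have e : 2 * 2 ^ s * (((n : ℝ) + 2) * (average a n ^ s / 2 ^ s / (2 * ((n : ℝ) + 1)))) =
      average a n ^ s * ((n + 2) / (n + 1)) := by
    field_simp
  rw [e]
  refine le_mul_of_one_le_right h0 ?_
  rw [one_le_div (by positivity)]
  linarith

/-- The `ℓ_1` estimate `∑_n ∑_{m ≥ n} f_m / m ≤ ∑_m f_m` for the adjoint of the averaging operator. -/
theorem sum_range_tsum_tail_le {f : ℕ → ℝ} (hf : ∀ n, 0 ≤ f n) (hsum : Summable f) (N : ℕ) :
    ∑ n ∈ Finset.range N, ∑' m, (if n ≤ m then f m / ((m : ℝ) + 1) else 0) ≤ ∑' m, f m := by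
  have hle (n m : ℕ) : (if n ≤ m then f m / ((m : ℝ) + 1) else 0) ≤ f m := by
    split_ifs
    · exact div_le_self (hf m) (by simp)
    · exact hf m
  have h0 (n m : ℕ) : 0 ≤ (if n ≤ m then f m / ((m : ℝ) + 1) else 0) := by
    split_ifs
    · exact div_nonneg (hf m) (by positivity)
    · exact le_rfl
  have hs (n : ℕ) : Summable fun m : ℕ => (if n ≤ m then f m / ((m : ℝ) + 1) else 0) :=
    hsum.of_nonneg_of_le (h0 n) (hle n)
  -- After the interchange, `f m / (m + 1)` is counted once for each `n ≤ m`, so at most `m + 1`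
  -- times.
  rw [← Summable.tsum_finsetSum fun n _ => hs n]
  refine (summable_sum fun n _ => hs n).tsum_le_tsum (fun m => ?_) hsum
  rw [← Finset.sum_filter, Finset.sum_const, nsmul_eq_mul]
  have hcard : ((Finset.range N).filter (· ≤ m)).card ≤ m + 1 := by
    rw [← Finset.card_range (m + 1)]
    refine Finset.card_le_card fun n hn => ?_
    rw [Finset.mem_filter] at hn
    exact Finset.mem_range.2 (Nat.lt_succ_of_le hn.2)
  have hcard' : (((Finset.range N).filter (· ≤ m)).card : ℝ) ≤ m + 1 := by exact_mod_cast hcard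
  calc _ ≤ ((m : ℝ) + 1) * (f m / ((m : ℝ) + 1)) :=
        mul_le_mul_of_nonneg_right hcard' (div_nonneg (hf m) (by positivity))
    _ = f m := mul_div_cancel₀ _ (by positivity)

/-- The bound is independent of `j ≥ n`, so it survives the supremum over `j`. -/
theorem average_rpow_le_tsum_tail {s : ℝ} (hs : 0 ≤ s) (ha : ∀ n, 0 ≤ a n)
    (hsum : Summable fun n => average a n ^ s) {n j : ℕ} (hnj : n ≤ j) :
    average a j ^ s ≤ 2 * 2 ^ s *
      ∑' m, (if n ≤ m then average a m ^ s / ((m : ℝ) + 1) else 0) := by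
  have hf (m : ℕ) : 0 ≤ average a m ^ s := Real.rpow_nonneg (average_nonneg ha m) s
  have h0 (m : ℕ) : 0 ≤ (if n ≤ m then average a m ^ s / ((m : ℝ) + 1) else 0) := by
    split_ifs
    · exact div_nonneg (hf m) (by positivity)
    · exact le_rfl
  have hs' : Summable fun m : ℕ => (if n ≤ m then average a m ^ s / ((m : ℝ) + 1) else 0) := by
    refine hsum.of_nonneg_of_le h0 fun m => ?_
    split_ifs
    · exact div_le_self (hf m) (by simp)
    · exact hf m
  refine (average_rpow_le_sum hs ha j).trans (mul_le_mul_of_nonneg_left ?_ (by positivity))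
  refine le_trans (Finset.sum_le_sum fun m hm => ?_)
    (hs'.sum_le_tsum (Finset.Ico j (2 * j + 2)) fun m _ => h0 m)
  rw [Finset.mem_Ico] at hm
  rw [if_pos (hnj.trans hm.1)]

end Averages

/-! ### Estimates for a single exponent -/

section SequenceSpaces

theorem norm_cesaro_modulus_eq (x : CSeq) (n : ℕ) :
    ‖cesaro (modulus x) n‖ = average (fun k => ‖x k‖) n :=
  norm_cesaro_modulus x n

theorem norm_cesaro_le (x : CSeq) (n : ℕ) : ‖cesaro x n‖ ≤ average (fun k => ‖x k‖) n := by
  have h : ‖(n : ℂ) + 1‖ = (n : ℝ) + 1 := by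
    rw [← Nat.cast_succ, Complex.norm_natCast, Nat.cast_succ]
  change ‖(∑ k ∈ Finset.range (n + 1), x k) / ((n : ℂ) + 1)‖ ≤ _
  rw [norm_div, h, average]
  gcongr
  exact norm_sum_le _ _

theorem exponent_toReal (q : Exponent) : 1 < q.1.toReal := by
  rw [← ENNReal.toReal_one]
  exact (ENNReal.toReal_lt_toReal ENNReal.one_ne_top q.2.2.ne).2 q.2.1

theorem exponent_toReal_pos (q : Exponent) : 0 < q.1.toReal :=
  zero_lt_one.trans (exponent_toReal q)

/-- A comparison of the partial sums of `q`-th powers with an `ℓ_q` norm. -/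
theorem exists_memℓp_norm_le {F G : Type*} [NormedAddCommGroup F] [NormedAddCommGroup G]
    (q : Exponent) {c : ℝ} (hc : 0 ≤ c) (f : ℕ → F) (g : lp (fun _ : ℕ => G) q.1)
    (h : ∀ N, ∑ n ∈ Finset.range N, ‖f n‖ ^ q.1.toReal ≤ c * ∑' n, ‖g n‖ ^ q.1.toReal) :
    ∃ hf : Memℓp f q.1,
      ‖(⟨f, hf⟩ : lp (fun _ : ℕ => F) q.1)‖ ≤ c ^ (q.1.toReal)⁻¹ * ‖g‖ := by
  have hq := exponent_toReal_pos q
  have h0 (n : ℕ) : 0 ≤ ‖f n‖ ^ q.1.toReal := Real.rpow_nonneg (norm_nonneg _) _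
  have hsum := summable_of_sum_range_le h0 h
  refine ⟨memℓp_gen hsum, ?_⟩
  rw [← Real.rpow_le_rpow_iff (norm_nonneg _) (by positivity) hq, Real.mul_rpow (by positivity)
    (norm_nonneg _), Real.rpow_inv_rpow hc hq.ne', lp.norm_rpow_eq_tsum hq, lp.norm_rpow_eq_tsum hq]
  exact hsum.tsum_le_of_sum_range_le h

theorem memℓp_infty_of_exponent {F : Type*} [NormedAddCommGroup F] {q : Exponent} {f : ℕ → F}
    (hf : Memℓp f q.1) : Memℓp f ∞ :=
  hf.of_exponent_ge le_top

theorem norm_le_hat_of_le {x : CSeq} (hx : Memℓp x ∞) {n m : ℕ} (h : n ≤ m) : ‖x m‖ ≤ hat x n := by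
  obtain ⟨k, rfl⟩ := Nat.exists_eq_add_of_le h
  exact norm_le_hat hx n k

theorem summable_average_of_mem_ces {q : Exponent} {x : CSeq} (hx : x ∈ ces q) :
    Summable fun n => average (fun k => ‖x k‖) n ^ q.1.toReal := by
  have h := (memℓp_gen_iff (exponent_toReal_pos q)).1 hx
  simpa only [norm_cesaro_modulus_eq] using h

theorem hat_cesaro_rpow_le {q : Exponent} {x : CSeq} (hx : x ∈ ces q) (n : ℕ) :
    hat (cesaro x) n ^ q.1.toReal ≤ 2 * 2 ^ q.1.toReal *
      ∑' m, (if n ≤ m then average (fun k => ‖x k‖) m ^ q.1.toReal / ((m : ℝ) + 1) else 0) := by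
  have hq := exponent_toReal_pos q
  have ha : ∀ k, 0 ≤ ‖x k‖ := fun k => norm_nonneg _
  have hs := summable_average_of_mem_ces hx
  have hb (j : ℕ) := average_rpow_le_tsum_tail hq.le ha hs (Nat.le_add_right n j)
  set T := 2 * 2 ^ q.1.toReal *
    ∑' m, (if n ≤ m then average (fun k => ‖x k‖) m ^ q.1.toReal / ((m : ℝ) + 1) else 0)
  have hT : 0 ≤ T := (Real.rpow_nonneg (average_nonneg ha _) _).trans (hb 0)
  -- The power is moved to the right so that the supremum stands alone and can be bounded termwise.
  rw [← Real.le_rpow_inv_iff_of_pos (hat_nonneg _ _) hT hq]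
  refine ciSup_le fun j => (norm_cesaro_le x _).trans ?_
  rw [Real.le_rpow_inv_iff_of_pos (average_nonneg ha _) hT hq]
  exact hb j

theorem exists_cesaro_mem_d_norm_le (q : Exponent) :
    ∃ K : ℝ, ∀ x : ces q, ∃ h : cesaro x.1 ∈ d q, dNorm q ⟨cesaro x.1, h⟩ ≤ K * cesNorm q x := by
  have hq := exponent_toReal_pos q
  refine ⟨(2 * 2 ^ q.1.toReal) ^ (q.1.toReal)⁻¹, fun x => ?_⟩
  have hA (n : ℕ) := average_nonneg (a := fun k => ‖x.1 k‖) (fun k => norm_nonneg _) n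
  obtain ⟨hf, hle⟩ := exists_memℓp_norm_le q (c := 2 * 2 ^ q.1.toReal) (by positivity)
    (hat (cesaro x.1)) (cesLp q x) fun N => by
      have h := sum_range_tsum_tail_le (fun n => Real.rpow_nonneg (hA n) q.1.toReal)
        (summable_average_of_mem_ces x.2) N
      have e (n : ℕ) : ‖cesLp q x n‖ = average (fun k => ‖x.1 k‖) n := norm_cesaro_modulus_eq x.1 n
      simp only [e, Real.norm_of_nonneg (hat_nonneg _ _)]
      refine le_trans (Finset.sum_le_sum fun n _ => hat_cesaro_rpow_le x.2 n) ?_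
      rw [← Finset.mul_sum]
      gcongr
  refine ⟨⟨?_, hf⟩, hle⟩
  exact (memℓp_infty_of_exponent x.2).mono' fun n =>
    (norm_cesaro_le _ n).trans (norm_cesaro_modulus_eq _ n).ge

theorem cesaro_mem_d {q : Exponent} {x : CSeq} (hx : x ∈ ces q) : cesaro x ∈ d q :=
  let ⟨_, hK⟩ := exists_cesaro_mem_d_norm_le q
  (hK ⟨x, hx⟩).1

/-- Hardy's inequality for `|x|`, followed by `|x| ≤ x̂`. -/
theorem exists_mem_ces_norm_le (q : Exponent) :
    ∃ K : ℝ, ∀ x : d q, ∃ h : x.1 ∈ ces q, cesNorm q ⟨x.1, h⟩ ≤ K * dNorm q x := by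
  have hq := exponent_toReal q
  have hc : 0 ≤ 2 * q.1.toReal / (q.1.toReal - 1) := div_nonneg (by linarith) (by linarith)
  refine ⟨((2 * q.1.toReal / (q.1.toReal - 1)) ^ q.1.toReal) ^ (q.1.toReal)⁻¹, fun x => ?_⟩
  exact exists_memℓp_norm_le q (Real.rpow_nonneg hc _) (cesaro (modulus x.1)) (dLp q x) fun N => by
    have hhat := (memℓp_gen_iff (exponent_toReal_pos q)).1 x.2.2
    have e (n : ℕ) : ‖dLp q x n‖ = ‖hat x.1 n‖ := rfl
    simp only [e, norm_cesaro_modulus_eq]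
    refine (sum_average_rpow_le hq (fun n => norm_nonneg _) N).trans ?_
    gcongr
    refine le_trans (Finset.sum_le_sum fun n _ => ?_)
      (hhat.sum_le_tsum (Finset.range N) fun n _ => by positivity)
    refine Real.rpow_le_rpow (norm_nonneg _) ?_ (by linarith)
    exact (norm_le_hat_of_le x.2.1 le_rfl).trans (Real.le_norm_self _)

theorem d_le_ces (q : Exponent) : d q ≤ ces q := fun x hx =>
  let ⟨_, hK⟩ := exists_mem_ces_norm_le q
  (hK ⟨x, hx⟩).1

theorem mem_ces_of_cesaro_modulus_mem_d {q : Exponent} {x : CSeq}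
    (hx : cesaro (modulus x) ∈ d q) : x ∈ ces q :=
  Memℓp.mono' hx.2 fun _ => (norm_le_hat_of_le hx.1 le_rfl).trans (Real.le_norm_self _)

theorem isSolid_ces (q : Exponent) : IsSolid (ces q) := fun x hx y hyx =>
  Memℓp.mono' hx fun n => by
    rw [norm_cesaro_modulus_eq, norm_cesaro_modulus_eq]
    exact average_mono hyx n

theorem norm_cesaro_cesaro_modulus (x : CSeq) (n : ℕ) :
    ‖cesaro (cesaro (modulus x)) n‖ = average (average fun k => ‖x k‖) n := by
  have h : cesaro (modulus x) = modulus (cesaro (modulus x)) := by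
    funext n
    rw [modulus, norm_cesaro_modulus]
    simp [cesaro, modulus]
  rw [h, norm_cesaro_modulus_eq]
  simp only [norm_cesaro_modulus_eq]

theorem cesaro_cesaro_modulus_mem_d_iff (q : Exponent) (x : CSeq) :
    cesaro (cesaro (modulus x)) ∈ d q ↔ cesaro (modulus x) ∈ d q := by
  refine ⟨fun h => ?_, fun h => cesaro_mem_d (d_le_ces q h)⟩
  -- The shift from `m` to `2m+1` costs nothing, since `hat` at `n` dominates every index from `n`
  -- on.
  have key {n m : ℕ} (hnm : n ≤ m) :
      ‖cesaro (modulus x) m‖ ≤ 4 * hat (cesaro (cesaro (modulus x))) n := by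
    rw [norm_cesaro_modulus_eq]
    refine (average_le_four_mul_average_average (fun _ => norm_nonneg _) m).trans ?_
    rw [← norm_cesaro_cesaro_modulus]
    gcongr
    exact norm_le_hat_of_le h.1 (by lia)
  have hhat := h.2.const_smul (4 : ℝ)
  refine ⟨?_, hhat.mono' fun n => ?_⟩
  · refine (memℓp_infty_of_exponent hhat).mono' fun n => ?_
    exact (key le_rfl).trans (Real.le_norm_self _)
  · rw [Real.norm_of_nonneg (hat_nonneg _ _)]
    exact (ciSup_le fun k => key (Nat.le_add_right n k)).trans (Real.le_norm_self _)

end SequenceSpaces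

/-! ### Passage to intersections and unions -/

section Scales

variable {E F : Scale}

theorem cesaroContinuous_of_norm_le (q : Exponent)
    (h : ∃ K : ℝ, ∀ x : E.space q, ∃ h : cesaro x.1 ∈ F.space q,
      F.norm q ⟨cesaro x.1, h⟩ ≤ K * E.norm q x) :
    CesaroContinuous (E.space q) (F.space q) (E.normTopology q) (F.normTopology q) := by
  obtain ⟨K, hK⟩ := h
  refine ⟨fun x hx => (hK ⟨x, hx⟩).1, ?_⟩
  let _ := (E.norm q).toSeminormedAddCommGroup
  let _ := (F.norm q).toSeminormedAddCommGroup
  exact AddMonoidHomClass.continuous_of_bound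
    (cesaro.restrict fun x hx => (hK ⟨x, hx⟩).1 : E.space q →ₗ[ℂ] F.space q) K
    fun x => (hK x).2

/-- Each norm defining the target has an exponent `r > q ≥ p`, so the same `r` already occurs in the
source. -/
theorem cesaroContinuous_plus
    (h : ∀ q, CesaroContinuous (E.space q) (F.space q) (E.normTopology q) (F.normTopology q))
    {p q : ℝ≥0∞} (hpq : p ≤ q) :
    CesaroContinuous (E.plus p) (F.plus q) (E.plusTopology p) (F.plusTopology q) := by
  refine ⟨fun x hx r hr => (h r).1 x (hx r (hpq.trans_lt hr)), ?_⟩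
  refine continuous_iInf_rng.2 fun r => continuous_iInf_rng.2 fun hr => continuous_induced_rng.2 ?_
  refine continuous_iInf_dom (i := r) (continuous_iInf_dom (i := hpq.trans_lt hr) ?_)
  let _ := E.normTopology r
  let _ := F.normTopology r
  obtain ⟨_, hc⟩ := h r
  let _ := (E.normTopology r).induced (Submodule.inclusion (E.plus_le r (hpq.trans_lt hr)))
  have hi : Continuous (Submodule.inclusion (E.plus_le r (hpq.trans_lt hr))) :=
    continuous_induced_dom
  exact hc.comp hi

theorem cesaroContinuous_minus
    (h : ∀ q, CesaroContinuous (E.space q) (F.space q) (E.normTopology q) (F.normTopology q))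
    {p q : ℝ≥0∞} (hpq : p ≤ q) :
    CesaroContinuous (E.minus p) (F.minus q) (E.minusTopology p) (F.minusTopology q) := by
  have hmap : ∀ x ∈ E.minus p, cesaro x ∈ F.minus q := by
    rintro x (rfl | ⟨r, hr, hx⟩)
    · rw [map_zero]; exact zero_mem _
    · exact F.le_minus r (hr.trans_le hpq) ((h r).1 x hx)
  refine ⟨hmap, continuous_sInf_rng.2 fun t ht => ?_⟩
  obtain ⟨h1, h2, h3, h4⟩ := ht
  rw [continuous_iff_le_induced]
  -- The pullback along `C` of a topology admissible for the target is admissible for the source,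
  -- hence coarser than the inductive limit topology.
  refine sInf_le ⟨?_, ?_, ?_, fun r hr => ?_⟩
  · exact topologicalAddGroup_induced (cesaro.restrict hmap)
  · exact continuousSMul_induced (cesaro.restrict hmap)
  · exact LocallyConvexSpace.induced (cesaro.restrict hmap |>.restrictScalars ℝ)
  · refine continuous_induced_rng.2 ?_
    let _ := E.normTopology r
    let _ := F.normTopology r
    obtain ⟨_, hc⟩ := h r
    exact (h4 r (hr.trans_le hpq)).comp hc

theorem cesaroContinuous_ces_d (q : Exponent) :
    CesaroContinuous (cesScale.space q) (dScale.space q)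
      (cesScale.normTopology q) (dScale.normTopology q) :=
  cesaroContinuous_of_norm_le q (exists_cesaro_mem_d_norm_le q)

theorem cesaroContinuous_d_d (q : Exponent) :
    CesaroContinuous (dScale.space q) (dScale.space q)
      (dScale.normTopology q) (dScale.normTopology q) := by
  refine cesaroContinuous_of_norm_le q ?_
  obtain ⟨K, hK⟩ := exists_cesaro_mem_d_norm_le q
  obtain ⟨L, hL⟩ := exists_mem_ces_norm_le q
  refine ⟨|K| * L, fun x => ?_⟩
  obtain ⟨hx, hxL⟩ := hL x
  obtain ⟨hy, hyK⟩ := hK ⟨x.1, hx⟩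
  refine ⟨hy, hyK.trans ?_⟩
  rw [mul_assoc]
  exact mul_le_mul (le_abs_self K) hxL (apply_nonneg _ _) (abs_nonneg K)

theorem norm_modulus (x : CSeq) (n : ℕ) : ‖modulus x n‖ = ‖x n‖ := by
  simp [modulus]

theorem isLargestSolidDomain_plus (p : ℝ≥0∞) :
    IsLargestSolidDomain (dScale.plus p) (cesScale.plus p) := by
  refine ⟨⟨fun x hx y hyx q hq => isSolid_ces q x (hx q hq) y hyx,
    fun x hx q hq => cesaro_mem_d (hx q hq)⟩, ?_⟩
  rintro Z ⟨hZ, hZd⟩ x hx q hq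
  -- Solidity is used only to replace `x` by `|x|`.
  have hmod := hZ x hx (modulus x) fun n => (norm_modulus x n).le
  exact mem_ces_of_cesaro_modulus_mem_d (hZd _ hmod q hq)

theorem isLargestSolidDomain_minus {p : ℝ≥0∞} (hp : 1 < p) :
    IsLargestSolidDomain (dScale.minus p) (cesScale.minus p) := by
  refine ⟨⟨fun x hx y hyx => ?_, fun x hx => ?_⟩, ?_⟩
  · rw [Scale.mem_minus _ hp] at hx ⊢
    obtain ⟨q, hq, hx⟩ := hx
    exact ⟨q, hq, isSolid_ces q x hx y hyx⟩
  · rw [Scale.mem_minus _ hp] at hx ⊢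
    obtain ⟨q, hq, hx⟩ := hx
    exact ⟨q, hq, cesaro_mem_d hx⟩
  · rintro Z ⟨hZ, hZd⟩ x hx
    have hmod := hZd _ (hZ x hx (modulus x) fun n => (norm_modulus x n).le)
    rw [Scale.mem_minus _ hp] at hmod ⊢
    obtain ⟨q, hq, hmod⟩ := hmod
    exact ⟨q, hq, mem_ces_of_cesaro_modulus_mem_d hmod⟩

end Scales

end CesaroScale

theorem proposition4p9 :
    ((∀ p q : ℝ≥0∞, 1 ≤ p → p ≤ q → q < ∞ →
        CesaroContinuous (dScale.plus p) (dScale.plus q)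
          (dScale.plusTopology p) (dScale.plusTopology q) ∧
        CesaroContinuous (cesScale.plus p) (dScale.plus q)
          (cesScale.plusTopology p) (dScale.plusTopology q)) ∧
      (∀ p : ℝ≥0∞, 1 ≤ p → p < ∞ → ∀ x : CSeq,
        cesaro (cesaro (modulus x)) ∈ dScale.plus p ↔ cesaro (modulus x) ∈ dScale.plus p) ∧
      (∀ p : ℝ≥0∞, 1 ≤ p → p < ∞ →
        IsLargestSolidDomain (dScale.plus p) (cesScale.plus p))) ∧
    ((∀ p q : ℝ≥0∞, 1 < p → p ≤ q →
        CesaroContinuous (dScale.minus p) (dScale.minus q)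
          (dScale.minusTopology p) (dScale.minusTopology q) ∧
        CesaroContinuous (cesScale.minus p) (dScale.minus q)
          (cesScale.minusTopology p) (dScale.minusTopology q)) ∧
      (∀ p : ℝ≥0∞, 1 < p → ∀ x : CSeq,
        cesaro (cesaro (modulus x)) ∈ dScale.minus p ↔ cesaro (modulus x) ∈ dScale.minus p) ∧
      (∀ p : ℝ≥0∞, 1 < p →
        IsLargestSolidDomain (dScale.minus p) (cesScale.minus p))) := by
  refine ⟨⟨fun p q _ hpq _ => ⟨cesaroContinuous_plus cesaroContinuous_d_d hpq,
      cesaroContinuous_plus cesaroContinuous_ces_d hpq⟩, fun p _ _ x => ?_,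
      fun p _ _ => isLargestSolidDomain_plus p⟩,
    ⟨fun p q _ hpq => ⟨cesaroContinuous_minus cesaroContinuous_d_d hpq,
      cesaroContinuous_minus cesaroContinuous_ces_d hpq⟩, fun p hp x => ?_,
      fun p hp => isLargestSolidDomain_minus hp⟩⟩
  · exact forall₂_congr fun q _ => cesaro_cesaro_modulus_mem_d_iff q x
  · rw [Scale.mem_minus _ hp, Scale.mem_minus _ hp]
    exact exists_congr fun q => and_congr_right fun _ => cesaro_cesaro_modulus_mem_d_iff q x
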